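/- **Proposition 4.4.** Let $R$ be a commutative artinian ring and $A$ an Artin $R$-algebra (an $R$-algebra that is finitely generated as an $R$-module), and let $A\text{-mod}$ be the category of finitely generated left $A$-modules. Let $F$ be an additive subbifunctor of $\mathrm{Ext}^1_A(-,-)$ on $A\text{-mod}$: subgroups $F(Z,X)\subseteq \mathrm{Ext}^1_A(Z,X)$ stable under pullback in $Z$ and pushout in $X$; write $\mathrm{Ext}^1_F(M,-)$ for the functor $F(M,-)$ from $A\text{-mod}$ to abelian groups. A short exact sequence $0\to X\to Y\xrightarrow{g} Z\to 0$ in $A\text{-mod}$ is *$F$-exact* if its class lies in $F(Z,X)$, and then $g$ is an *$F$-epimorphism*. A module $P\in A\text{-mod}$ is *$F$-projective* if $\mathrm{Hom}_A(P,-)$ sends every $F$-exact sequence to an exact sequence. Assume that $F$ has enough projectives, i.e. every module in $A\text{-mod}$ is the target of an $F$-epimorphism from an $F$-projective module. An *$F$-projective cover* of $M$ is an $F$-epimorphism $p:P(M)\to M$ with $P(M)$ $F$-projective such that every endomorphism $h$ of $P(M)$ with $p\circ h=p$ is an automorphism. The *$F$-stable category* of $A\text{-mod}$ has the same objects as $A\text{-mod}$,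 and its morphisms are those of $A\text{-mod}$ modulo the maps that factor through an $F$-projective module. Let $K_F(A)$ be the free abelian group on the isomorphism classes $[M]$ of modules in $A\text{-mod}$ modulo the relations $[N]-[X]-[Y]$ whenever $N\cong X\oplus Y$, and $[P]$ whenever $P$ is $F$-projective. For $M,N\in A\text{-mod}$ the following conditions are equivalent: (a) $\mathrm{Ext}^1_F(M,-)\cong \mathrm{Ext}^1_F(N,-)$ as functors from $A\text{-mod}$ to abelian groups; (b) there are $F$-projective covers $P(M)\to M$ and $P(N)\to N$ with $M\oplus P(N)\cong N\oplus P(M)$ in $A\text{-mod}$; (b') there are $F$-projective modules $P$ and $Q$ with $M\oplus P\cong N\oplus Q$ in $A\text{-mod}$; (c) $M\cong N$ in the $F$-stable category of $A\text{-mod}$; (d) $[M]=[N]$ in $K_F(A)$. -/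

import Mathlib

open CategoryTheory CategoryTheory.Abelian

universe u

noncomputable section

namespace RelHom

variable {A : Type u} [Ring A]

/-- An additive subbifunctor `F` of `Ext¹_A(-,-)` on the category `A-mod` of finitely generated
left `A`-modules: a subgroup `F(M, N) ⊆ Ext¹_A(M, N)` for all `M`, `N`, stable under the
functoriality of `Ext¹` in both variables (pushouts and pullbacks of extensions). -/
structure ExtSubbifunctor (A : Type u) [Ring A] where
  /-- The subgroup `F(M, N)` of `Ext¹_A(M, N)`. -/
  sub (M N : FGModuleCat.{u} A) : AddSubgroup (Ext.{u} M.obj N.obj 1)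
  /-- Stability under pushout along a morphism of the second variable. -/
  push {M N N' : FGModuleCat.{u} A} (g : N ⟶ N') {e : Ext.{u} M.obj N.obj 1}
    (he : e ∈ sub M N) : e.comp (Ext.mk₀ g.hom) (add_zero 1) ∈ sub M N'
  /-- Stability under pullback along a morphism of the first variable. -/
  pull {M M' N : FGModuleCat.{u} A} (f : M' ⟶ M) {e : Ext.{u} M.obj N.obj 1}
    (he : e ∈ sub M N) : (Ext.mk₀ f.hom).comp e (zero_add 1) ∈ sub M' N

variable (F : ExtSubbifunctor A)

/-- A sequence `0 ⟶ X ⟶ Y ⟶ Z ⟶ 0` of finitely generated modules is `F`-exact if it is exact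
and its class in `Ext¹_A(Z, X)` lies in `F(Z, X)`. -/
def FExact (S : ShortComplex (FGModuleCat.{u} A)) : Prop :=
  ∃ h : (S.map (ModuleCat.isFG.{u} A).ι).ShortExact, h.extClass ∈ F.sub S.X₃ S.X₁

/-- `P` is `F`-projective if `Hom_A(P, -)` sends `F`-exact sequences to exact ones; as
`Hom_A(P, -)` is left exact, this is the surjectivity of `Hom_A(P, Y) ⟶ Hom_A(P, Z)`. -/
def FProjective (P : FGModuleCat.{u} A) : Prop :=
  ∀ S : ShortComplex (FGModuleCat.{u} A), FExact F S →
    ∀ f : P ⟶ S.X₃, ∃ g : P ⟶ S.X₂, g ≫ S.g = f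

/-- A morphism is an `F`-epimorphism if it is the second map of an `F`-exact sequence. -/
def FEpi {Y Z : FGModuleCat.{u} A} (p : Y ⟶ Z) : Prop :=
  ∃ (X : FGModuleCat.{u} A) (i : X ⟶ Y) (w : i ≫ p = 0), FExact F (ShortComplex.mk i p w)

/-- `F` has enough projectives: each module in `A-mod` is the target of an `F`-epimorphism from
an `F`-projective module. -/
def EnoughFProjectives : Prop :=
  ∀ M : FGModuleCat.{u} A, ∃ (P : FGModuleCat.{u} A) (p : P ⟶ M), FProjective F P ∧ FEpi F p

/-- `p : P ⟶ M` is an `F`-projective cover: `P` is `F`-projective, `p` is an `F`-epimorphism, and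
`p` is right minimal. -/
def IsFProjectiveCover {P M : FGModuleCat.{u} A} (p : P ⟶ M) : Prop :=
  FProjective F P ∧ FEpi F p ∧ ∀ h : P ⟶ P, h ≫ p = p → IsIso h

/-- The direct sum of two finitely generated modules. -/
abbrev dsum (M N : FGModuleCat.{u} A) : FGModuleCat.{u} A := FGModuleCat.of A (M × N)

/-- The functor `Ext¹_F(M, -) = F(M, -) : A-mod ⥤ Ab`. -/
def extF (M : FGModuleCat.{u} A) : FGModuleCat.{u} A ⥤ AddCommGrpCat.{u} where
  obj N := AddCommGrpCat.of (F.sub M N)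
  map {N N'} g := AddCommGrpCat.ofHom
    ((((Ext.mk₀ g.hom).postcomp M.obj (add_zero 1)).comp (F.sub M N).subtype).codRestrict
      (F.sub M N') (fun e => F.push g e.2))
  map_id N := by
    ext e
    exact Ext.comp_mk₀_id (e : Ext.{u} M.obj N.obj 1)
  map_comp {N N' N''} g g' := by
    ext e
    change (e : Ext.{u} M.obj N.obj 1).comp (Ext.mk₀ (g ≫ g').hom) (add_zero 1) =
      ((e : Ext.{u} M.obj N.obj 1).comp (Ext.mk₀ g.hom) (add_zero 1)).comp
        (Ext.mk₀ g'.hom) (add_zero 1)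
    rw [ObjectProperty.FullSubcategory.comp_hom, ← Ext.mk₀_comp_mk₀]
    symm
    apply Ext.comp_assoc
    lia

/-- Two parallel morphisms are `F`-stably equal if their difference factors through an
`F`-projective module. -/
def stableRel : HomRel (FGModuleCat.{u} A) := fun X Y f g =>
  ∃ (P : FGModuleCat.{u} A) (a : X ⟶ P) (b : P ⟶ Y), FProjective F P ∧ f - g = a ≫ b

/-- A direct sum of `F`-projective modules is `F`-projective. -/
lemma FProjective.dsum {P Q : FGModuleCat.{u} A} (hP : FProjective F P) (hQ : FProjective F Q) :
    FProjective F (dsum P Q) := by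
  intro S hS f
  obtain ⟨g₁, h₁⟩ := hP S hS (FGModuleCat.ofHom (LinearMap.inl A P Q) ≫ f)
  obtain ⟨g₂, h₂⟩ := hQ S hS (FGModuleCat.ofHom (LinearMap.inr A P Q) ≫ f)
  refine ⟨FGModuleCat.ofHom (LinearMap.fst A P Q) ≫ g₁ +
    FGModuleCat.ofHom (LinearMap.snd A P Q) ≫ g₂, ?_⟩
  rw [Preadditive.add_comp, Category.assoc, Category.assoc, h₁, h₂]
  apply FGModuleCat.hom_ext
  apply LinearMap.ext
  rintro ⟨x, y⟩
  change f.hom.hom (x, 0) + f.hom.hom (0, y) = f.hom.hom (x, y)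
  rw [← map_add]
  simp

/-- The zero module is `F`-projective. -/
lemma FProjective.punit : FProjective F (FGModuleCat.of A PUnit) := by
  intro S _ f
  refine ⟨0, ?_⟩
  ext x
  have hx : x = 0 := Subsingleton.elim (α := PUnit) _ _
  rw [hx, map_zero, map_zero]

/-- `F`-stable equality is a congruence, so that the morphisms of the quotient category by it are
exactly the groups `Hom_A(X, Y)` modulo the maps that factor through `F`-projective modules. -/
instance : Congruence (stableRel F) where
  comp_left := by
    rintro X Y Z f g g' ⟨P, a, b, hP, h⟩
    exact ⟨P, f ≫ a, b, hP, by rw [← Preadditive.comp_sub, h, Category.assoc]⟩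
  comp_right := by
    rintro X Y Z f f' g ⟨P, a, b, hP, h⟩
    exact ⟨P, a, b ≫ g, hP, by rw [← Preadditive.sub_comp, h, Category.assoc]⟩
  equivalence :=
    { refl := fun f => ⟨_, 0, 0, FProjective.punit F, by simp⟩
      symm := fun {f g} ⟨P, a, b, hP, h⟩ =>
        ⟨P, -a, b, hP, by rw [Preadditive.neg_comp, ← h, neg_sub]⟩
      trans := fun {f g k} h₁ h₂ => by
        obtain ⟨P, a, b, hP, h⟩ := h₁
        obtain ⟨Q, c, d, hQ, h'⟩ := h₂
        refine ⟨_, FGModuleCat.ofHom (a.hom.hom.prod c.hom.hom),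
          FGModuleCat.ofHom (b.hom.hom.coprod d.hom.hom), hP.dsum F hQ, ?_⟩
        rw [← sub_add_sub_cancel f g k, h, h']
        ext x
        rfl }

/-- The `F`-stable category of `A-mod`: same objects, morphisms modulo those that factor through
`F`-projective modules. -/
abbrev FStable := CategoryTheory.Quotient (stableRel F)

/-- A finitely generated module, as an object of the `F`-stable category. -/
abbrev toFStable (M : FGModuleCat.{u} A) : FStable F :=
  (CategoryTheory.Quotient.functor (stableRel F)).obj M

/-- The type of isomorphism classes of finitely generated `A`-modules. -/
abbrev IsoClass (A : Type u) [Ring A] :=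
  _root_.Quotient (isIsomorphicSetoid (FGModuleCat.{u} A))

/-- The generator of the free abelian group on isomorphism classes given by `M`. -/
def gen (M : FGModuleCat.{u} A) : FreeAbelianGroup (IsoClass A) :=
  FreeAbelianGroup.of (Quotient.mk (isIsomorphicSetoid (FGModuleCat.{u} A)) M)

/-- The relations of `K_F(A)`: `[N] - [X] - [Y]` whenever `N ≅ X ⊕ Y`, and `[P]` whenever `P` is
`F`-projective. -/
def relKF : Set (FreeAbelianGroup (IsoClass A)) :=
  {x | ∃ N X Y : FGModuleCat.{u} A, Nonempty (N ≅ dsum X Y) ∧ x = gen N - gen X - gen Y} ∪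
    {x | ∃ P : FGModuleCat.{u} A, FProjective F P ∧ x = gen P}

/-- The group `K_F(A)`. -/
abbrev KF := FreeAbelianGroup (IsoClass A) ⧸ AddSubgroup.closure (relKF F)

/-- The class `[M]` in `K_F(A)`. -/
def classKF (M : FGModuleCat.{u} A) : KF F := QuotientAddGroup.mk (gen M)

end RelHom

end

section Cancellation

variable {A : Type*} [Ring A]

/-- If the corner `X → X` of an isomorphism `X × B ≃ X × C` is bijective, then `B ≃ C`. -/
lemma LinearEquiv.nonempty_of_prod_of_bijective {X B C : Type*} [AddCommGroup X] [Module A X]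
    [AddCommGroup B] [Module A B] [AddCommGroup C] [Module A C] (φ : (X × B) ≃ₗ[A] X × C)
    (h : Function.Bijective fun x : X => (φ (x, 0)).1) : Nonempty (B ≃ₗ[A] C) := by
  let f : C →ₗ[A] B := LinearMap.snd A X B ∘ₗ φ.symm.toLinearMap ∘ₗ LinearMap.inr A X C
  have hf (c : C) : f c = (φ.symm (0, c)).2 := rfl
  refine ⟨(LinearEquiv.ofBijective f ⟨?_, fun b => ?_⟩).symm⟩
  · rw [injective_iff_map_eq_zero]
    intro c hc
    rw [hf] at hc
    have h1 : φ ((φ.symm (0, c)).1, 0) = (0, c) := by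
      rw [← hc, Prod.mk.eta, φ.apply_symm_apply]
    have h2 : (φ.symm (0, c)).1 = 0 := h.1 (by
      change (φ ((φ.symm (0, c)).1, 0)).1 = (φ ((0 : X), (0 : B))).1
      rw [h1, Prod.mk_zero_zero, map_zero]; rfl)
    rw [h2, Prod.mk_zero_zero, map_zero] at h1
    exact (congrArg Prod.snd h1).symm
  · obtain ⟨x, hx⟩ := h.2 (-(φ (0, b)).1)
    refine ⟨(φ (x, b)).2, ?_⟩
    have h1 : φ (x, b) = (0, (φ (x, b)).2) := by
      refine Prod.ext ?_ rfl
      have : ((x, b) : X × B) = (x, 0) + (0, b) := by simp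
      rw [this, map_add, Prod.fst_add]
      change (φ (x, 0)).1 = _ at hx
      rw [hx]; simp
    rw [hf, ← h1, φ.symm_apply_apply]

/-- Fitting's lemma: an endomorphism of an indecomposable module of finite length is nilpotent or
bijective. -/
lemma Module.End.isNilpotent_or_isUnit_of_indecomposable {X : Type*} [AddCommGroup X] [Module A X]
    [IsArtinian A X] [IsNoetherian A X]
    (hX : ∀ p q : Submodule A X, IsCompl p q → p = ⊥ ∨ q = ⊥) (f : Module.End A X) :
    IsNilpotent f ∨ IsUnit f := by
  obtain ⟨n, hn, hn1⟩ := (f.eventually_isCompl_ker_pow_range_pow.and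
    (Filter.eventually_ge_atTop 1)).exists
  rcases hX _ _ hn with h | h
  · right
    rw [Module.End.isUnit_iff]
    apply IsArtinian.bijective_of_injective_endomorphism
    have h1 : Function.Injective (f ^ n) := LinearMap.ker_eq_bot.1 h
    obtain ⟨m, rfl⟩ : ∃ m, n = m + 1 := ⟨n - 1, by omega⟩
    rw [pow_succ] at h1
    exact Function.Injective.of_comp (f := (f ^ m : Module.End A X)) h1
  · left
    exact ⟨n, LinearMap.range_eq_bot.1 h⟩

/-- An indecomposable module of finite length cancels from direct sums. -/
lemma LinearEquiv.nonempty_of_prod_of_indecomposable {X B C : Type*} [AddCommGroup X] [Module A X]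
    [AddCommGroup B] [Module A B] [AddCommGroup C] [Module A C]
    [IsArtinian A X] [IsNoetherian A X]
    (hX : ∀ p q : Submodule A X, IsCompl p q → p = ⊥ ∨ q = ⊥)
    (φ : (X × B) ≃ₗ[A] X × C) : Nonempty (B ≃ₗ[A] C) := by
  let a : Module.End A X := LinearMap.fst A X C ∘ₗ φ.toLinearMap ∘ₗ LinearMap.inl A X B
  let b : B →ₗ[A] X := LinearMap.fst A X C ∘ₗ φ.toLinearMap ∘ₗ LinearMap.inr A X B
  let a' : Module.End A X := LinearMap.fst A X B ∘ₗ φ.symm.toLinearMap ∘ₗ LinearMap.inl A X C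
  let c' : X →ₗ[A] B := LinearMap.snd A X B ∘ₗ φ.symm.toLinearMap ∘ₗ LinearMap.inl A X C
  have hφ (x : X) (y : B) : (φ (x, y)).1 = a x + b y := by
    have : ((x, y) : X × B) = (x, 0) + (0, y) := by simp
    rw [this, map_add]; rfl
  have hsum : a * a' + (b ∘ₗ c' : Module.End A X) = 1 := by
    ext x
    change a (a' x) + b (c' x) = x
    rw [← hφ]
    change (φ (φ.symm (x, 0))).1 = x
    rw [φ.apply_symm_apply]
  by_cases ha : IsUnit a
  · exact φ.nonempty_of_prod_of_bijective ((Module.End.isUnit_iff a).1 ha)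
  · have hnil (y : Module.End A X) : IsNilpotent (a * y) := by
      refine (Module.End.isNilpotent_or_isUnit_of_indecomposable hX _).resolve_right fun h => ha ?_
      rw [Module.End.isUnit_iff] at h ⊢
      exact IsNoetherian.bijective_of_surjective_endomorphism a
        (Function.Surjective.of_comp (g := (y : X → X)) h.2)
    have hu : IsUnit (b ∘ₗ c' : Module.End A X) := by
      rw [← eq_sub_iff_add_eq'] at hsum
      rw [hsum]
      exact (hnil a').isUnit_one_sub
    have hv : IsUnit (a + b ∘ₗ c' : Module.End A X) := by
      obtain ⟨u, hu⟩ := hu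
      rw [← hu]
      have : a + (u : Module.End A X) = (1 + a * (u⁻¹ : (Module.End A X)ˣ)) * u := by
        rw [add_mul, one_mul, mul_assoc, Units.inv_mul, mul_one, add_comm]
      rw [this]
      exact (hnil _).isUnit_one_add.mul u.isUnit
    refine (((LinearEquiv.refl A X).skewProd (LinearEquiv.refl A B) c').trans
      φ).nonempty_of_prod_of_bijective ?_
    convert (Module.End.isUnit_iff _).1 hv using 2 with x
    simp [LinearEquiv.skewProd_apply, hφ]

universe w in
/-- Modules of finite length cancel from direct sums. -/
lemma LinearEquiv.nonempty_of_prod {X B C : Type w} [AddCommGroup X] [Module A X]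
    [AddCommGroup B] [Module A B] [AddCommGroup C] [Module A C]
    [IsArtinian A X] [IsNoetherian A X]
    (φ : (X × B) ≃ₗ[A] X × C) : Nonempty (B ≃ₗ[A] C) := by
  obtain ⟨n, hn⟩ : ∃ n, n = Module.length A X := ⟨_, rfl⟩
  induction n using WellFoundedLT.induction generalizing X B C with
  | ind n ih =>
    by_cases hX : ∀ p q : Submodule A X, IsCompl p q → p = ⊥ ∨ q = ⊥
    · exact φ.nonempty_of_prod_of_indecomposable hX
    · push Not at hX
      obtain ⟨p, q, hpq, hp, hq⟩ := hX
      have hp' : p ≠ ⊤ := fun h => hq (by simpa [h] using hpq.inf_eq_bot)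
      have hq' : q ≠ ⊤ := fun h => hp (by simpa [h] using hpq.inf_eq_bot)
      let e := Submodule.prodEquivOfIsCompl p q hpq
      obtain ⟨φ'⟩ := ih _ (hn ▸ Submodule.length_lt hp')
        (((LinearEquiv.prodAssoc A p q B).symm.trans (e.prodCongr (LinearEquiv.refl A B))).trans
          (φ.trans ((LinearEquiv.prodAssoc A p q C).symm.trans
            (e.prodCongr (LinearEquiv.refl A C))).symm)) rfl
      exact ih _ (hn ▸ Submodule.length_lt hq') φ' rfl

end Cancellation

noncomputable section

section Realization

open Limits

/-- In an abelian category with enough projectives, each class in `Ext¹` is the class of a short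
exact sequence. -/
lemma CategoryTheory.Abelian.Ext.exists_extClass_eq {C : Type*} [Category C] [Abelian C]
    [HasExt C] [EnoughProjectives C] {X Z : C} (e : Ext Z X 1) :
    ∃ (Y : C) (f : X ⟶ Y) (g : Y ⟶ Z) (w : f ≫ g = 0)
      (h : (ShortComplex.mk f g w).ShortExact), h.extClass = e := by
  let S : ShortComplex C := ShortComplex.mk (kernel.ι (Projective.π Z)) (Projective.π Z)
    (kernel.condition _)
  have hS : S.ShortExact :=
    { exact := ShortComplex.exact_of_f_is_kernel _ (kernelIsKernel _)
      mono_f := inferInstanceAs (Mono (kernel.ι _))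
      epi_g := inferInstanceAs (Epi (Projective.π Z)) }
  have : Mono S.f := hS.mono_f
  have : Epi S.g := hS.epi_g
  obtain ⟨x, hx⟩ := Ext.contravariant_sequence_exact₃ hS X e
    (Ext.eq_zero_of_projective (P := Projective.over Z) _) (add_zero 1)
  obtain ⟨k, rfl⟩ := Ext.addEquiv₀.symm.surjective x
  let d : pushout S.f k ⟶ Z := pushout.desc S.g 0 (by simp)
  have hd₁ : pushout.inl S.f k ≫ d = S.g := pushout.inl_desc _ _ _
  have hd₂ : pushout.inr S.f k ≫ d = 0 := pushout.inr_desc _ _ _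
  have hepi : Epi d := by
    have : Epi (pushout.inl S.f k ≫ d) := hd₁ ▸ hS.epi_g
    exact epi_of_epi (pushout.inl S.f k) d
  let T : ShortComplex C := ShortComplex.mk (pushout.inr S.f k) d hd₂
  have hT : T.ShortExact :=
    { exact := by
        apply ShortComplex.exact_of_g_is_cokernel
        refine CokernelCofork.IsColimit.ofπ' _ _ fun {W} l hl => ?_
        have hl' : S.f ≫ pushout.inl S.f k ≫ l = 0 := by
          rw [pushout.condition_assoc]
          change k ≫ T.f ≫ l = 0
          rw [hl]
          exact Limits.comp_zero
        refine ⟨hS.gIsCokernel.desc (CokernelCofork.ofπ _ hl'), ?_⟩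
        apply pushout.hom_ext
        · change pushout.inl S.f k ≫ d ≫ _ = _
          rw [reassoc_of% hd₁]
          exact hS.gIsCokernel.fac (CokernelCofork.ofπ _ hl') WalkingParallelPair.one
        · change pushout.inr S.f k ≫ d ≫ _ = _
          rw [reassoc_of% hd₂]
          exact Limits.zero_comp.trans hl.symm
      mono_f := inferInstanceAs (Mono (pushout.inr S.f k))
      epi_g := hepi }
  refine ⟨_, T.f, T.g, T.zero, hT, ?_⟩
  have := ShortComplex.ShortExact.extClass_naturality hS hT
    { τ₁ := k, τ₂ := pushout.inl S.f k, τ₃ := 𝟙 Z, comm₁₂ := pushout.condition.symm,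
      comm₂₃ := by rw [Category.comp_id]; exact hd₁ }
  rw [Ext.mk₀_id_comp] at this
  rw [← this]
  exact hx

end Realization

namespace RelHom

variable {A : Type u} [Ring A] {F : ExtSubbifunctor A}

lemma FEpi.exists_lift {Y Z : FGModuleCat.{u} A} {p : Y ⟶ Z} (hp : FEpi F p)
    {P : FGModuleCat.{u} A} (hP : FProjective F P) (f : P ⟶ Z) : ∃ g : P ⟶ Y, g ≫ p = f := by
  obtain ⟨X, i, w, h⟩ := hp
  exact hP _ h f

lemma FProjective.of_retract {P Q : FGModuleCat.{u} A} (hP : FProjective F P) (i : Q ⟶ P)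
    (r : P ⟶ Q) (h : i ≫ r = 𝟙 Q) : FProjective F Q := by
  intro S hS f
  obtain ⟨g, hg⟩ := hP S hS (r ≫ f)
  exact ⟨i ≫ g, by rw [Category.assoc, hg, reassoc_of% h]⟩

/-- `F(P, -)` vanishes if `P` is `F`-projective. -/
lemma FProjective.eq_zero {P X : FGModuleCat.{u} A} (hP : FProjective F P)
    {e : Ext.{u} P.obj X.obj 1} (he : e ∈ F.sub P X) : e = 0 := by
  obtain ⟨Y, i, p, w, h, rfl⟩ := Ext.exists_extClass_eq e
  have hY : Module.Finite A Y := by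
    have hX : Module.Finite A X.obj := X.property
    have hP : Module.Finite A P.obj := P.property
    refine Module.finite_def.2 (Submodule.fg_of_fg_map_of_fg_inf_ker p.hom ?_ ?_)
    · rw [Submodule.map_top, LinearMap.range_eq_top.2 h.moduleCat_surjective_g]
      exact hP.fg_top
    · rw [top_inf_eq, ← h.exact.moduleCat_range_eq_ker, LinearMap.range_eq_map]
      exact hX.fg_top.map _
  let S : ShortComplex (FGModuleCat.{u} A) :=
    ShortComplex.mk (X₁ := X) (X₂ := ⟨Y, hY⟩) (X₃ := P) ⟨i⟩ ⟨p⟩ (by ext1; exact congrArg _ w)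
  obtain ⟨s, hs⟩ := hP S ⟨h, he⟩ (𝟙 P)
  have h1 : (Ext.mk₀ (s.hom ≫ p)).comp h.extClass (zero_add 1) = 0 := by
    rw [← Ext.mk₀_comp_mk₀, Ext.comp_assoc _ _ _ (add_zero 0) (zero_add 1) (by lia), h.comp_extClass, Ext.comp_zero]
  have h2 : s.hom ≫ p = 𝟙 P.obj := congrArg (fun f => f.hom) hs
  rwa [h2, Ext.mk₀_id_comp] at h1

lemma extF_hom_ext {M N : FGModuleCat.{u} A} {η θ : extF F M ⟶ extF F N}
    (h : ∀ (X : FGModuleCat.{u} A) (e : F.sub M X),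
      ((η.app X).hom e : F.sub N X) = (θ.app X).hom e) : η = θ :=
  NatTrans.ext (funext fun X => AddCommGrpCat.hom_ext (AddMonoidHom.ext (h X)))

/-- The map `F(M, -) ⟶ F(N, -)` given by a morphism `N ⟶ M`. -/
def extFMap {M N : FGModuleCat.{u} A} (f : N ⟶ M) : extF F M ⟶ extF F N where
  app X := AddCommGrpCat.ofHom
    ((((Ext.mk₀ f.hom).precomp X.obj (zero_add 1)).comp (F.sub M X).subtype).codRestrict
      (F.sub N X) (fun e => F.pull f e.2))
  naturality X Y g := by
    refine AddCommGrpCat.hom_ext (AddMonoidHom.ext fun e : F.sub M X => Subtype.ext ?_)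
    exact (Ext.comp_assoc (Ext.mk₀ f.hom) e.1 (Ext.mk₀ g.hom) (zero_add 1) (add_zero 1)
      (by lia)).symm

lemma extFMap_id (M : FGModuleCat.{u} A) : extFMap (F := F) (𝟙 M) = 𝟙 _ :=
  extF_hom_ext fun _ e => Subtype.ext (Ext.mk₀_id_comp e.1)

lemma extFMap_comp {M N L : FGModuleCat.{u} A} (f : N ⟶ M) (g : L ⟶ N) :
    extFMap (F := F) (g ≫ f) = extFMap f ≫ extFMap g := by
  refine extF_hom_ext fun X e => Subtype.ext ?_
  change (Ext.mk₀ (g.hom ≫ f.hom)).comp e.1 (zero_add 1) =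
    (Ext.mk₀ g.hom).comp ((Ext.mk₀ f.hom).comp e.1 (zero_add 1)) (zero_add 1)
  rw [← Ext.mk₀_comp_mk₀]
  apply Ext.comp_assoc
  lia

lemma mk₀_comp_sub_mk₀_comp {C : Type*} [Category C] [Abelian C] [HasExt C] {X Y Z : C}
    (f g : X ⟶ Y) (e : Ext Y Z 1) :
    (Ext.mk₀ f).comp e (zero_add 1) - (Ext.mk₀ g).comp e (zero_add 1) =
      (Ext.mk₀ (f - g)).comp e (zero_add 1) := by
  rw [sub_eq_add_neg, sub_eq_add_neg, Ext.mk₀_add, Ext.mk₀_neg, Ext.add_comp, Ext.neg_comp]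

lemma extFMap_eq_of_stableRel {M N : FGModuleCat.{u} A} {f g : N ⟶ M} (h : stableRel F f g) :
    extFMap (F := F) f = extFMap g := by
  obtain ⟨P, a, b, hP, h⟩ := h
  refine extF_hom_ext fun X e => Subtype.ext ?_
  change (Ext.mk₀ f.hom).comp e.1 (zero_add 1) = (Ext.mk₀ g.hom).comp e.1 (zero_add 1)
  rw [← sub_eq_zero, mk₀_comp_sub_mk₀_comp]
  have h1 : f.hom - g.hom = a.hom ≫ b.hom := congrArg (fun f => f.hom) h
  rw [h1, ← Ext.mk₀_comp_mk₀, Ext.comp_assoc _ _ _ (add_zero 0) (zero_add 1) (by lia),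
    hP.eq_zero (F.pull b e.2), Ext.comp_zero]

/-- Isomorphism in the `F`-stable category, in terms of representatives. -/
lemma nonempty_iso_toFStable_iff {M N : FGModuleCat.{u} A} :
    Nonempty (toFStable F M ≅ toFStable F N) ↔
      ∃ (f : M ⟶ N) (g : N ⟶ M), stableRel F (f ≫ g) (𝟙 M) ∧ stableRel F (g ≫ f) (𝟙 N) := by
  let Q := CategoryTheory.Quotient.functor (stableRel F)
  constructor
  · rintro ⟨φ⟩
    obtain ⟨f, hf⟩ := Q.map_surjective φ.hom
    obtain ⟨g, hg⟩ := Q.map_surjective φ.inv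
    refine ⟨f, g, ?_, ?_⟩
    · rw [← CategoryTheory.Quotient.functor_map_eq_iff (stableRel F)]
      change Q.map (f ≫ g) = Q.map (𝟙 M)
      rw [Q.map_comp, hf, hg, φ.hom_inv_id, Q.map_id]
    · rw [← CategoryTheory.Quotient.functor_map_eq_iff (stableRel F)]
      change Q.map (g ≫ f) = Q.map (𝟙 N)
      rw [Q.map_comp, hf, hg, φ.inv_hom_id, Q.map_id]
  · rintro ⟨f, g, hfg, hgf⟩
    refine ⟨⟨Q.map f, Q.map g, ?_, ?_⟩⟩
    · rw [← Q.map_comp, ← Q.map_id]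
      exact CategoryTheory.Quotient.sound _ hfg
    · rw [← Q.map_comp, ← Q.map_id]
      exact CategoryTheory.Quotient.sound _ hgf

/-- Stably isomorphic modules have isomorphic functors `Ext¹_F`. -/
lemma nonempty_extF_iso_of_stable {M N : FGModuleCat.{u} A} {f : M ⟶ N} {g : N ⟶ M}
    (hfg : stableRel F (f ≫ g) (𝟙 M)) (hgf : stableRel F (g ≫ f) (𝟙 N)) :
    Nonempty (extF F M ≅ extF F N) :=
  ⟨⟨extFMap g, extFMap f,
    by rw [← extFMap_comp, extFMap_eq_of_stableRel hfg, extFMap_id],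
    by rw [← extFMap_comp, extFMap_eq_of_stableRel hgf, extFMap_id]⟩⟩

/-- The properties of an `F`-exact sequence `0 ⟶ K ⟶ P ⟶ M ⟶ 0` with `F`-projective middle term
and class `ε` from which the functor `F(M, -)` is computed. -/
lemma exists_presentation (hF : EnoughFProjectives F) (M : FGModuleCat.{u} A) :
    ∃ (P K : FGModuleCat.{u} A) (p : P ⟶ M) (i : K ⟶ P) (ε : F.sub M K), FProjective F P ∧
      (∀ (X : FGModuleCat.{u} A) (e : F.sub M X), ∃ g : K ⟶ X,
        ε.1.comp (Ext.mk₀ g.hom) (add_zero 1) = e.1) ∧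
      ε.1.comp (Ext.mk₀ i.hom) (add_zero 1) = 0 ∧
      (∀ (N : FGModuleCat.{u} A) (e : Ext.{u} N.obj K.obj 1),
        e.comp (Ext.mk₀ i.hom) (add_zero 1) = 0 →
          ∃ f : N ⟶ M, (Ext.mk₀ f.hom).comp ε.1 (zero_add 1) = e) ∧
      ∀ (N : FGModuleCat.{u} A) (f : N ⟶ M),
        (Ext.mk₀ f.hom).comp ε.1 (zero_add 1) = 0 → ∃ k : N ⟶ P, k ≫ p = f := by
  obtain ⟨P, p, hP, K, i, w, h, hmem⟩ := hF M
  refine ⟨P, K, p, i, ⟨h.extClass, hmem⟩, hP, fun X e => ?_, h.extClass_comp, fun N e he => ?_,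
    fun N f hf => ?_⟩
  · obtain ⟨x, hx⟩ := Ext.contravariant_sequence_exact₃ h X.obj e.1
      (hP.eq_zero (F.pull p e.2)) (add_zero 1)
    obtain ⟨k, rfl⟩ := Ext.addEquiv₀.symm.surjective x
    exact ⟨⟨k⟩, hx⟩
  · obtain ⟨x, hx⟩ := Ext.covariant_sequence_exact₁ N.obj h e he (zero_add 1)
    obtain ⟨k, rfl⟩ := Ext.addEquiv₀.symm.surjective x
    exact ⟨⟨k⟩, hx⟩
  · obtain ⟨x, hx⟩ := Ext.covariant_sequence_exact₃ N.obj h (Ext.mk₀ f.hom) (zero_add 1) hf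
    obtain ⟨k, rfl⟩ := Ext.addEquiv₀.symm.surjective x
    exact ⟨⟨k⟩, ObjectProperty.hom_ext _
      ((Ext.mk₀_bijective _ _).1 ((Ext.mk₀_comp_mk₀ _ _).symm.trans hx))⟩

lemma extF_naturality_apply {M N : FGModuleCat.{u} A} (η : extF F M ⟶ extF F N)
    {X Y : FGModuleCat.{u} A} (g : X ⟶ Y) (e : F.sub M X) :
    ((η.app Y).hom (⟨_, F.push g e.2⟩ : F.sub M Y) : F.sub N Y).1 =
      ((η.app X).hom e : F.sub N X).1.comp (Ext.mk₀ g.hom) (add_zero 1) := by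
  have h := congrArg (fun φ => φ.hom e) (η.naturality g)
  rw [AddCommGrpCat.hom_comp, AddCommGrpCat.hom_comp] at h
  exact congrArg Subtype.val h

/-- Each natural transformation `F(M, -) ⟶ F(N, -)` comes from a morphism `N ⟶ M`. -/
lemma extFMap_surjective (hF : EnoughFProjectives F) {M N : FGModuleCat.{u} A}
    (η : extF F M ⟶ extF F N) : ∃ f : N ⟶ M, extFMap f = η := by
  obtain ⟨P, K, p, i, ε, hP, hgen, hε, hlift, -⟩ := exists_presentation hF M
  have hη (X : FGModuleCat.{u} A) (g : K ⟶ X) (e : F.sub M X)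
      (he : ε.1.comp (Ext.mk₀ g.hom) (add_zero 1) = e.1) :
      ((η.app X).hom e : F.sub N X).1 =
        ((η.app K).hom ε : F.sub N K).1.comp (Ext.mk₀ g.hom) (add_zero 1) := by
    obtain rfl : (⟨_, F.push g ε.2⟩ : F.sub M X) = e := Subtype.ext he
    exact extF_naturality_apply η g ε
  obtain ⟨f, hf⟩ := hlift N ((η.app K).hom ε : F.sub N K).1
    ((hη P i 0 hε).symm.trans (congrArg Subtype.val ((η.app P).hom.map_zero)))
  refine ⟨f, extF_hom_ext fun X e => Subtype.ext ?_⟩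
  obtain ⟨g, hg⟩ := hgen X e
  rw [hη X g e hg, ← hf]
  change (Ext.mk₀ f.hom).comp e.1 (zero_add 1) = _
  rw [← hg]
  symm
  apply Ext.comp_assoc
  lia

/-- Morphisms that induce the same map on `F(M, -)` are stably equal. -/
lemma stableRel_of_extFMap_eq (hF : EnoughFProjectives F) {M N : FGModuleCat.{u} A}
    {f g : N ⟶ M} (hfg : extFMap (F := F) f = extFMap g) : stableRel F f g := by
  obtain ⟨P, K, p, i, ε, hP, -, -, -, hker⟩ := exists_presentation hF M
  have h : (Ext.mk₀ f.hom).comp ε.1 (zero_add 1) = (Ext.mk₀ g.hom).comp ε.1 (zero_add 1) :=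
    congrArg (fun η : extF F M ⟶ extF F N => ((η.app K).hom ε : F.sub N K).1) hfg
  obtain ⟨k, hk⟩ := hker N (f - g) ((mk₀_comp_sub_mk₀_comp _ _ _).symm.trans (sub_eq_zero.2 h))
  exact ⟨P, k, p, hP, hk.symm⟩

lemma exists_stable_of_extF_iso (hF : EnoughFProjectives F) {M N : FGModuleCat.{u} A}
    (φ : extF F M ≅ extF F N) :
    ∃ (f : M ⟶ N) (g : N ⟶ M), stableRel F (f ≫ g) (𝟙 M) ∧ stableRel F (g ≫ f) (𝟙 N) := by
  obtain ⟨g, hg⟩ := extFMap_surjective hF φ.hom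
  obtain ⟨f, hf⟩ := extFMap_surjective hF φ.inv
  exact ⟨f, g,
    stableRel_of_extFMap_eq hF (by rw [extFMap_comp, hf, hg, φ.hom_inv_id, extFMap_id]),
    stableRel_of_extFMap_eq hF (by rw [extFMap_comp, hf, hg, φ.inv_hom_id, extFMap_id])⟩

end RelHom

end

noncomputable section

namespace RelHom

variable {A : Type u} [Ring A] {F : ExtSubbifunctor A}

lemma isIso_iff_bijective {M N : FGModuleCat.{u} A} (f : M ⟶ N) :
    IsIso f ↔ Function.Bijective f.hom.hom := by
  refine ⟨fun _ => (FGModuleCat.isoToLinearEquiv (asIso f)).bijective, fun h => ?_⟩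
  exact (LinearEquiv.ofBijective f.hom.hom h).toFGModuleCatIso.isIso_hom

lemma hom_congr {M N : FGModuleCat.{u} A} {f g : M ⟶ N} (h : f = g) (x : M) :
    f.hom.hom x = g.hom.hom x := by
  rw [h]

lemma hom_ext_apply {M N : FGModuleCat.{u} A} {f g : M ⟶ N}
    (h : ∀ x : M, f.hom.hom x = g.hom.hom x) : f = g :=
  FGModuleCat.hom_ext (LinearMap.ext h)

lemma nonempty_iso_iff {M N : FGModuleCat.{u} A} :
    Nonempty (M ≅ N) ↔ Nonempty (M ≃ₗ[A] N) :=
  ⟨fun ⟨e⟩ => ⟨FGModuleCat.isoToLinearEquiv e⟩, fun ⟨e⟩ => ⟨e.toFGModuleCatIso⟩⟩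

/-- If an `F`-epimorphism factors through `q`, then `q` is an `F`-epimorphism. -/
lemma FEpi.of_comp [IsNoetherianRing A] {P Q M : FGModuleCat.{u} A} (r : P ⟶ Q) (q : Q ⟶ M)
    (h : FEpi F (r ≫ q)) : FEpi F q := by
  obtain ⟨K, i, w, hex, hmem⟩ := h
  have hsurj : Function.Surjective (r ≫ q).hom.hom := hex.moduleCat_surjective_g
  let L : FGModuleCat.{u} A := FGModuleCat.of A (LinearMap.ker q.hom.hom)
  let j : L ⟶ Q := FGModuleCat.ofHom (LinearMap.ker q.hom.hom).subtype
  have hj : j ≫ q = 0 := by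
    ext x
    exact x.2
  let S : ShortComplex (FGModuleCat.{u} A) := ShortComplex.mk j q hj
  have hS : (S.map (ModuleCat.isFG.{u} A).ι).ShortExact :=
    { exact := by
        rw [ShortComplex.moduleCat_exact_iff]
        intro x hx
        exact ⟨(⟨x, hx⟩ : LinearMap.ker q.hom.hom), rfl⟩
      mono_f := (ModuleCat.mono_iff_injective _).2 (Submodule.injective_subtype _)
      epi_g := (ModuleCat.epi_iff_surjective _).2
        (Function.Surjective.of_comp (g := (r.hom.hom : P → Q)) hsurj) }
  let k : K ⟶ L := FGModuleCat.ofHom ((r.hom.hom ∘ₗ i.hom.hom).codRestrict _ fun x =>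
    hom_congr w x)
  refine ⟨L, j, hj, hS, ?_⟩
  have hnat := ShortComplex.ShortExact.extClass_naturality hex hS
    { τ₁ := k.hom, τ₂ := r.hom, τ₃ := 𝟙 M.obj, comm₁₂ := rfl, comm₂₃ := rfl }
  have h₁ := F.push k hmem
  rwa [show hS.extClass = _ from hnat.trans (Ext.mk₀_id_comp _) |>.symm]

/-- `F`-projective covers exist. -/
lemma exists_isFProjectiveCover [IsArtinianRing A] (hF : EnoughFProjectives F)
    (M : FGModuleCat.{u} A) : ∃ (P : FGModuleCat.{u} A) (p : P ⟶ M), IsFProjectiveCover F p := by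
  obtain ⟨P, p, hP, hp⟩ := hF M
  obtain ⟨n, hn⟩ : ∃ n, n = Module.length A P := ⟨_, rfl⟩
  induction n using WellFoundedLT.induction generalizing P with
  | ind n ih =>
    by_cases hmin : ∀ h : P ⟶ P, h ≫ p = p → IsIso h
    · exact ⟨P, p, hP, hp, hmin⟩
    push Not at hmin
    obtain ⟨h, hhp, hh⟩ := hmin
    let f : Module.End A P := h.hom.hom
    have hf (x : P) : p.hom.hom (f x) = p.hom.hom x :=
      hom_congr hhp x
    have hfn (n : ℕ) (x : P) : p.hom.hom ((f ^ n) x) = p.hom.hom x := by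
      induction n with
      | zero => rfl
      | succ n ih => rw [pow_succ', Module.End.mul_apply, hf, ih]
    obtain ⟨m, hm, hm1⟩ := (f.eventually_isCompl_ker_pow_range_pow.and
      (Filter.eventually_ge_atTop 1)).exists
    have hne : LinearMap.range (f ^ m) ≠ ⊤ := by
      intro htop
      apply hh
      rw [isIso_iff_bijective]
      apply IsNoetherian.bijective_of_surjective_endomorphism f
      obtain ⟨m, rfl⟩ : ∃ k, m = k + 1 := ⟨m - 1, by omega⟩
      rw [pow_succ'] at htop
      exact Function.Surjective.of_comp (g := (f ^ m : Module.End A P))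
        (LinearMap.range_eq_top.1 htop)
    let Q : FGModuleCat.{u} A := FGModuleCat.of A (LinearMap.range (f ^ m))
    let i : Q ⟶ P := FGModuleCat.ofHom (LinearMap.range (f ^ m)).subtype
    let r : P ⟶ Q := FGModuleCat.ofHom (Submodule.projectionOnto _ _ hm.symm)
    have hir : i ≫ r = 𝟙 Q := by
      ext1
      exact Submodule.projectionOnto_comp_subtype hm.symm
    have hrip : r ≫ i ≫ p = p := by
      ext x
      have h0 := Submodule.sub_projection_mem hm.symm x
      rw [LinearMap.mem_ker] at h0
      have h1 := hfn m (x - Submodule.projection _ _ hm.symm x)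
      rw [h0, map_zero, map_sub, eq_comm, sub_eq_zero] at h1
      exact h1.symm
    exact ih _ (hn ▸ Submodule.length_lt hne) Q (i ≫ p) (hP.of_retract i r hir)
      (FEpi.of_comp r _ (hrip.symm ▸ hp)) rfl

/-- A right minimal right approximation of `M` by `F`-projective modules. -/
structure IsMinimalFApproximation (F : ExtSubbifunctor A) {P M : FGModuleCat.{u} A} (p : P ⟶ M) :
    Prop where
  fProjective : FProjective F P
  exists_lift {Q : FGModuleCat.{u} A} (hQ : FProjective F Q) (f : Q ⟶ M) : ∃ g : Q ⟶ P, g ≫ p = f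
  isIso (h : P ⟶ P) (w : h ≫ p = p) : IsIso h

lemma IsFProjectiveCover.isMinimalFApproximation {P M : FGModuleCat.{u} A} {p : P ⟶ M}
    (hp : IsFProjectiveCover F p) : IsMinimalFApproximation F p :=
  ⟨hp.1, hp.2.1.exists_lift, hp.2.2⟩

namespace IsMinimalFApproximation

lemma nonempty_iso {P Q M N : FGModuleCat.{u} A} {p : P ⟶ M} {q : Q ⟶ N}
    (hp : IsMinimalFApproximation F p) (hq : IsMinimalFApproximation F q) (e : M ≅ N) :
    Nonempty (P ≅ Q) := by
  obtain ⟨a, ha⟩ := hq.exists_lift hp.fProjective (p ≫ e.hom)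
  obtain ⟨b, hb⟩ := hp.exists_lift hq.fProjective (q ≫ e.inv)
  have h₁ : IsIso (a ≫ b) := hp.isIso _ (by
    rw [Category.assoc, hb, reassoc_of% ha, e.hom_inv_id, Category.comp_id])
  have h₂ : IsIso (b ≫ a) := hq.isIso _ (by
    rw [Category.assoc, ha, reassoc_of% hb, e.inv_hom_id, Category.comp_id])
  rw [isIso_iff_bijective] at h₁ h₂
  have : IsIso a := (isIso_iff_bijective a).2
    ⟨Function.Injective.of_comp (f := (b.hom.hom : Q → P)) h₁.1,
      Function.Surjective.of_comp (g := (b.hom.hom : Q → P)) h₂.2⟩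
  exact ⟨asIso a⟩

/-- The sum of a minimal approximation `P ⟶ M` and of the identity of an `F`-projective module. -/
lemma dsum {P M Q : FGModuleCat.{u} A} {p : P ⟶ M} (hp : IsMinimalFApproximation F p)
    (hQ : FProjective F Q) : IsMinimalFApproximation F
      (FGModuleCat.ofHom (p.hom.hom.prodMap LinearMap.id) : dsum P Q ⟶ dsum M Q) where
  fProjective := hp.fProjective.dsum F hQ
  exists_lift {T} hT f := by
    obtain ⟨g, hg⟩ := hp.exists_lift hT (f ≫ FGModuleCat.ofHom (LinearMap.fst A M Q))
    refine ⟨FGModuleCat.ofHom (g.hom.hom.prod (LinearMap.snd A M Q ∘ₗ f.hom.hom)), ?_⟩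
    ext x
    · exact hom_congr hg x
    · rfl
  isIso h w := by
    let f : (P × Q) →ₗ[A] P × Q := h.hom.hom
    have hw (z : P × Q) : (p.hom.hom (f z).1, (f z).2) = (p.hom.hom z.1, z.2) :=
      hom_congr w z
    let a : P →ₗ[A] P := LinearMap.fst A P Q ∘ₗ f ∘ₗ LinearMap.inl A P Q
    have ha : Function.Bijective a := (isIso_iff_bijective (FGModuleCat.ofHom a : P ⟶ P)).1 <|
      hp.isIso _ (by
        ext x
        exact congrArg Prod.fst (hw (x, 0)))
    have hf (x : P) (y : Q) : f (x, y) = (a x + (f (0, y)).1, y) := by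
      have hy : (f (x, y)).2 = y := congrArg Prod.snd (hw (x, y))
      refine Prod.ext ?_ hy
      have : ((x, y) : P × Q) = (x, 0) + (0, y) := by simp
      rw [this, map_add]
      rfl
    rw [isIso_iff_bijective]
    change Function.Bijective f
    refine ⟨(injective_iff_map_eq_zero f).2 ?_, ?_⟩
    · rintro ⟨x, y⟩ hxy
      rw [hf] at hxy
      obtain rfl : y = 0 := congrArg Prod.snd hxy
      have hx := congrArg Prod.fst hxy
      rw [Prod.mk_zero_zero, map_zero] at hx
      have hx' : a x = 0 := (add_zero _).symm.trans hx
      rw [(map_eq_zero_iff a ha.1).1 hx', Prod.mk_zero_zero]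
    · rintro ⟨x, y⟩
      obtain ⟨z, hz⟩ := ha.2 (x - (f (0, y)).1)
      exact ⟨(z, y), by rw [hf, hz, sub_add_cancel]⟩

end IsMinimalFApproximation

end RelHom

end

noncomputable section

namespace RelHom

variable {A : Type u} [Ring A] {F : ExtSubbifunctor A}

/-- Adding an `F`-projective module does not change the stable isomorphism class. -/
lemma nonempty_iso_toFStable_dsum (M : FGModuleCat.{u} A) {P : FGModuleCat.{u} A}
    (hP : FProjective F P) : Nonempty (toFStable F M ≅ toFStable F (dsum M P)) := by
  rw [nonempty_iso_toFStable_iff]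
  refine ⟨FGModuleCat.ofHom (LinearMap.inl A M P), FGModuleCat.ofHom (LinearMap.fst A M P), ?_, ?_⟩
  · exact Congruence.equivalence.refl _
  · refine ⟨P, FGModuleCat.ofHom (LinearMap.snd A M P), -FGModuleCat.ofHom (LinearMap.inr A M P),
      hP, ?_⟩
    refine hom_ext_apply fun x : M × P => ?_
    change ((x.1, 0) : M × P) - x = -((0, x.2) : M × P)
    ext <;> simp

/-- A retraction that is a stable isomorphism splits off an `F`-projective module. -/
lemma exists_linearEquiv_of_stableRel {M N : FGModuleCat.{u} A} {s : M ⟶ N} {t : N ⟶ M}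
    (hst : s ≫ t = 𝟙 M) (hts : stableRel F (t ≫ s) (𝟙 N)) :
    ∃ Q : FGModuleCat.{u} A, FProjective F Q ∧ Nonempty (N ≃ₗ[A] M × Q) := by
  have hs (x : M) : t.hom.hom (s.hom.hom x) = x := hom_congr hst x
  let r : N →ₗ[A] LinearMap.ker t.hom.hom :=
    (LinearMap.id - s.hom.hom ∘ₗ t.hom.hom).codRestrict _ fun x => by
      change t.hom.hom (x - s.hom.hom (t.hom.hom x)) = 0
      rw [map_sub, hs, sub_self]
  have hr (x : N) : (r x : N) = x - s.hom.hom (t.hom.hom x) := rfl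
  have hr' (x : LinearMap.ker t.hom.hom) : r x = x := by
    refine Subtype.ext ?_
    rw [hr, show t.hom.hom x = 0 from x.2, map_zero, sub_zero]
  have : Module.Finite A (LinearMap.ker t.hom.hom) :=
    Module.Finite.of_surjective r fun x => ⟨x, hr' x⟩
  obtain ⟨P, a, b, hP, hab⟩ := hts
  have hab' (x : N) : s.hom.hom (t.hom.hom x) - x = b.hom.hom (a.hom.hom x) := hom_congr hab x
  refine ⟨FGModuleCat.of A (LinearMap.ker t.hom.hom), ?_, ⟨?_⟩⟩
  · refine hP.of_retract (-(FGModuleCat.ofHom (LinearMap.ker t.hom.hom).subtype ≫ a))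
      (b ≫ FGModuleCat.ofHom r) ?_
    refine hom_ext_apply fun x : LinearMap.ker t.hom.hom => ?_
    change r (b.hom.hom (-a.hom.hom x.1)) = x
    rw [map_neg, ← hab', show t.hom.hom x.1 = 0 from x.2, map_zero, zero_sub, neg_neg, hr']
  · refine LinearEquiv.ofBijective (t.hom.hom.prod r) ⟨(injective_iff_map_eq_zero _).2 ?_, ?_⟩
    · intro x hx
      have h₁ : t.hom.hom x = 0 := congrArg Prod.fst hx
      have h₂ : (r x : N) = 0 := congrArg Subtype.val (congrArg Prod.snd hx)
      rwa [hr, h₁, map_zero, sub_zero] at h₂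
    · rintro ⟨x, y⟩
      have hy : t.hom.hom (y : N) = 0 := y.2
      refine ⟨s.hom.hom x + y, Prod.ext ?_ (Subtype.ext ?_)⟩
      · change t.hom.hom (s.hom.hom x + y) = x
        rw [map_add, hs, hy, add_zero]
      · change s.hom.hom x + (y : N) - s.hom.hom (t.hom.hom (s.hom.hom x + y)) = y
        rw [map_add, hs, hy, add_zero, add_sub_cancel_left]

variable (F) in
/-- Two modules are `F`-equivalent if they become isomorphic after adding `F`-projective
modules. -/
def FEquivalent (M N : FGModuleCat.{u} A) : Prop :=
  ∃ P Q : FGModuleCat.{u} A, FProjective F P ∧ FProjective F Q ∧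
    Nonempty ((M × P) ≃ₗ[A] N × Q)

lemma fEquivalent_of_stable {M N : FGModuleCat.{u} A} {f : M ⟶ N} {g : N ⟶ M}
    (hfg : stableRel F (f ≫ g) (𝟙 M)) (hgf : stableRel F (g ≫ f) (𝟙 N)) :
    FEquivalent F M N := by
  obtain ⟨P, a, b, hP, hab⟩ := hfg
  have hab' (x : M) : g.hom.hom (f.hom.hom x) - x = b.hom.hom (a.hom.hom x) := hom_congr hab x
  let s : M ⟶ dsum N P := FGModuleCat.ofHom (f.hom.hom.prod a.hom.hom)
  let t : dsum N P ⟶ M := FGModuleCat.ofHom (g.hom.hom.coprod (-b.hom.hom))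
  have hst : s ≫ t = 𝟙 M := by
    ext x
    change g.hom.hom (f.hom.hom x) + -b.hom.hom (a.hom.hom x) = x
    rw [← hab', ← sub_eq_add_neg, sub_sub_cancel]
  have hts : stableRel F (t ≫ s) (𝟙 (dsum N P)) := by
    let fst : dsum N P ⟶ N := FGModuleCat.ofHom (LinearMap.fst A N P)
    let inl : N ⟶ dsum N P := FGModuleCat.ofHom (LinearMap.inl A N P)
    have h₁ : stableRel F t (fst ≫ g) := by
      refine ⟨P, FGModuleCat.ofHom (LinearMap.snd A N P), -b, hP, ?_⟩
      exact hom_ext_apply fun x : N × P => add_sub_cancel_left (g.hom.hom x.1) (-b.hom.hom x.2)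
    have h₂ : stableRel F s (f ≫ inl) := by
      refine ⟨P, a, FGModuleCat.ofHom (LinearMap.inr A N P), hP, ?_⟩
      refine hom_ext_apply fun x => ?_
      change ((f.hom.hom x, a.hom.hom x) : N × P) - (f.hom.hom x, 0) = (0, a.hom.hom x)
      simp
    have h₃ : stableRel F (fst ≫ inl) (𝟙 (dsum N P)) := by
      refine ⟨P, FGModuleCat.ofHom (LinearMap.snd A N P),
        -FGModuleCat.ofHom (LinearMap.inr A N P), hP, ?_⟩
      refine hom_ext_apply fun x : N × P => ?_
      change ((x.1, 0) : N × P) - x = -((0, x.2) : N × P)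
      ext <;> simp
    have trans {X Y : FGModuleCat.{u} A} {f g h : X ⟶ Y} (h₁ : stableRel F f g)
        (h₂ : stableRel F g h) : stableRel F f h := Congruence.equivalence.trans h₁ h₂
    refine trans (HomRel.comp_right s h₁) (trans (HomRel.comp_left (fst ≫ g) h₂)
      (trans ?_ h₃))
    have h₄ : stableRel F (fst ≫ (g ≫ f) ≫ inl) (fst ≫ 𝟙 N ≫ inl) :=
      HomRel.comp_left fst (HomRel.comp_right inl hgf)
    rwa [Category.id_comp, Category.assoc, ← Category.assoc] at h₄
  obtain ⟨Q, hQ, ⟨e⟩⟩ := exists_linearEquiv_of_stableRel hst hts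
  exact ⟨Q, P, hQ, hP, ⟨e.symm⟩⟩

lemma nonempty_iso_toFStable_of_fEquivalent {M N : FGModuleCat.{u} A} (h : FEquivalent F M N) :
    Nonempty (toFStable F M ≅ toFStable F N) := by
  obtain ⟨P, Q, hP, hQ, ⟨e⟩⟩ := h
  obtain ⟨e₁⟩ := nonempty_iso_toFStable_dsum M hP
  obtain ⟨e₂⟩ := nonempty_iso_toFStable_dsum N hQ
  exact ⟨e₁ ≪≫ (CategoryTheory.Quotient.functor (stableRel F)).mapIso e.toFGModuleCatIso ≪≫ e₂.symm⟩

/-- Finitely generated modules over an artinian ring cancel from direct sums. -/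
lemma nonempty_linearEquiv_of_prod [IsArtinianRing A] {M N X : FGModuleCat.{u} A}
    (e : (X × M) ≃ₗ[A] X × N) : Nonempty (M ≃ₗ[A] N) :=
  e.nonempty_of_prod

/-- Equivalent modules have projective covers with `M ⊕ P(N) ≅ N ⊕ P(M)`. -/
lemma FEquivalent.exists_cover [IsArtinianRing A] (hF : EnoughFProjectives F)
    {M N : FGModuleCat.{u} A} (h : FEquivalent F M N) :
    ∃ (PM PN : FGModuleCat.{u} A) (p : PM ⟶ M) (q : PN ⟶ N),
      IsFProjectiveCover F p ∧ IsFProjectiveCover F q ∧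
        Nonempty (RelHom.dsum M PN ≅ RelHom.dsum N PM) := by
  obtain ⟨P, Q, hP, hQ, ⟨e⟩⟩ := h
  obtain ⟨PM, p, hp⟩ := exists_isFProjectiveCover hF M
  obtain ⟨PN, q, hq⟩ := exists_isFProjectiveCover hF N
  refine ⟨PM, PN, p, q, hp, hq, nonempty_iso_iff.2 ?_⟩
  obtain ⟨e'⟩ := nonempty_iso_iff.1 ((hp.isMinimalFApproximation.dsum hP).nonempty_iso
    (hq.isMinimalFApproximation.dsum hQ) e.toFGModuleCatIso)
  have e'' : (PM × P) ≃ₗ[A] PN × Q := e'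
  refine nonempty_linearEquiv_of_prod (X := RelHom.dsum P Q) ?_
  change ((P × Q) × (M × PN)) ≃ₗ[A] (P × Q) × (N × PM)
  exact (LinearEquiv.prodProdProdComm A P Q M PN).trans <|
    (((LinearEquiv.prodComm A P M).trans e).prodCongr
      ((LinearEquiv.prodComm A Q PN).trans e''.symm)).trans <|
    (LinearEquiv.prodComm A _ _).trans <|
    (LinearEquiv.prodProdProdComm A PM P N Q).trans <|
    (LinearEquiv.prodComm A _ _).trans <|
    (LinearEquiv.refl A _).prodCongr (LinearEquiv.prodComm A PM N)

namespace FEquivalent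

lemma of_linearEquiv {M N : FGModuleCat.{u} A} (e : M ≃ₗ[A] N) : FEquivalent F M N :=
  ⟨_, _, FProjective.punit F, FProjective.punit F, ⟨e.prodCongr (LinearEquiv.refl A _)⟩⟩

lemma symm {M N : FGModuleCat.{u} A} (h : FEquivalent F M N) : FEquivalent F N M := by
  obtain ⟨P, Q, hP, hQ, ⟨e⟩⟩ := h
  exact ⟨Q, P, hQ, hP, ⟨e.symm⟩⟩

lemma trans {M N L : FGModuleCat.{u} A} (h : FEquivalent F M N) (h' : FEquivalent F N L) :
    FEquivalent F M L := by
  obtain ⟨P, Q, hP, hQ, ⟨e⟩⟩ := h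
  obtain ⟨P', Q', hP', hQ', ⟨e'⟩⟩ := h'
  refine ⟨_, _, hP.dsum F hP', hQ'.dsum F hQ, ⟨?_⟩⟩
  change (M × (P × P')) ≃ₗ[A] L × (Q' × Q)
  exact (LinearEquiv.prodAssoc A M P P').symm.trans <|
    (e.prodCongr (LinearEquiv.refl A P')).trans <|
    (LinearEquiv.prodAssoc A N Q P').trans <|
    ((LinearEquiv.refl A N).prodCongr (LinearEquiv.prodComm A Q P')).trans <|
    (LinearEquiv.prodAssoc A N P' Q).symm.trans <|
    (e'.prodCongr (LinearEquiv.refl A Q)).trans (LinearEquiv.prodAssoc A L Q' Q)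

lemma dsum {M N M' N' : FGModuleCat.{u} A} (h : FEquivalent F M N) (h' : FEquivalent F M' N') :
    FEquivalent F (dsum M M') (dsum N N') := by
  obtain ⟨P, Q, hP, hQ, ⟨e⟩⟩ := h
  obtain ⟨P', Q', hP', hQ', ⟨e'⟩⟩ := h'
  refine ⟨_, _, hP.dsum F hP', hQ.dsum F hQ', ⟨?_⟩⟩
  change ((M × M') × (P × P')) ≃ₗ[A] (N × N') × (Q × Q')
  exact (LinearEquiv.prodProdProdComm A M M' P P').trans <|
    (e.prodCongr e').trans (LinearEquiv.prodProdProdComm A N Q N' Q')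

lemma of_dsum [IsArtinianRing A] {M N X : FGModuleCat.{u} A}
    (h : FEquivalent F (RelHom.dsum M X) (RelHom.dsum N X)) : FEquivalent F M N := by
  obtain ⟨P, Q, hP, hQ, ⟨e⟩⟩ := h
  refine ⟨P, Q, hP, hQ, nonempty_linearEquiv_of_prod (M := RelHom.dsum M P) (N := RelHom.dsum N Q)
    (X := X) ?_⟩
  change (X × (M × P)) ≃ₗ[A] X × (N × Q)
  have e' : ((M × X) × P) ≃ₗ[A] (N × X) × Q := e
  exact (LinearEquiv.prodAssoc A X M P).symm.trans <|
    ((LinearEquiv.prodComm A X M).prodCongr (LinearEquiv.refl A P)).trans <|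
    e'.trans <| ((LinearEquiv.prodComm A N X).prodCongr (LinearEquiv.refl A Q)).trans
      (LinearEquiv.prodAssoc A X N Q)

lemma of_fProjective {P : FGModuleCat.{u} A} (hP : FProjective F P) :
    FEquivalent F P (FGModuleCat.of A PUnit) :=
  ⟨_, P, FProjective.punit F, hP, ⟨LinearEquiv.prodComm A _ _⟩⟩

end FEquivalent

variable (F) in
/-- The setoid of `F`-equivalence. -/
def fEquivalentSetoid : Setoid (FGModuleCat.{u} A) where
  r := FEquivalent F
  iseqv := ⟨fun _ => .of_linearEquiv (LinearEquiv.refl A _), .symm, .trans⟩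

variable (F) in
/-- The monoid of `F`-equivalence classes of modules, with the direct sum as addition. -/
def FClass : Type (u + 1) := _root_.Quotient (fEquivalentSetoid F)

namespace FClass

variable (F) in
/-- The `F`-equivalence class of a module. -/
def mk (M : FGModuleCat.{u} A) : FClass F := Quotient.mk (fEquivalentSetoid F) M

lemma mk_eq_mk_iff {M N : FGModuleCat.{u} A} : mk F M = mk F N ↔ FEquivalent F M N :=
  Quotient.eq (r := fEquivalentSetoid F)

lemma mk_surjective (x : FClass F) : ∃ M, mk F M = x := Quotient.exists_rep x

instance : Zero (FClass F) := ⟨mk F (FGModuleCat.of A PUnit)⟩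

instance : Add (FClass F) :=
  ⟨Quotient.map₂ dsum fun _ _ h _ _ h' => FEquivalent.dsum h h'⟩

lemma mk_add_mk (M N : FGModuleCat.{u} A) : mk F M + mk F N = mk F (dsum M N) := rfl

lemma mk_eq_of_linearEquiv {M N : FGModuleCat.{u} A} (e : M ≃ₗ[A] N) : mk F M = mk F N :=
  mk_eq_mk_iff.2 (.of_linearEquiv e)

lemma mk_eq_zero {P : FGModuleCat.{u} A} (hP : FProjective F P) : mk F P = 0 :=
  mk_eq_mk_iff.2 (.of_fProjective hP)

protected lemma add_comm (x y : FClass F) : x + y = y + x := by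
  obtain ⟨M, rfl⟩ := mk_surjective x
  obtain ⟨N, rfl⟩ := mk_surjective y
  exact mk_eq_of_linearEquiv (LinearEquiv.prodComm A M N)

protected lemma zero_add (x : FClass F) : 0 + x = x := by
  obtain ⟨M, rfl⟩ := mk_surjective x
  exact mk_eq_of_linearEquiv (M := dsum (FGModuleCat.of A PUnit) M) (LinearEquiv.uniqueProd)

instance : AddCommMonoid (FClass F) where
  add_assoc x y z := by
    obtain ⟨M, rfl⟩ := mk_surjective x
    obtain ⟨N, rfl⟩ := mk_surjective y
    obtain ⟨L, rfl⟩ := mk_surjective z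
    exact mk_eq_of_linearEquiv (LinearEquiv.prodAssoc A M N L)
  zero_add := FClass.zero_add
  add_zero x := (FClass.add_comm x 0).trans (FClass.zero_add x)
  add_comm := FClass.add_comm
  nsmul := nsmulRec

instance [IsArtinianRing A] : IsRightCancelAdd (FClass F) where
  add_right_cancel x y z h := by
    obtain ⟨X, rfl⟩ := mk_surjective x
    obtain ⟨M, rfl⟩ := mk_surjective y
    obtain ⟨N, rfl⟩ := mk_surjective z
    exact mk_eq_mk_iff.2 (mk_eq_mk_iff.1 h).of_dsum

instance [IsArtinianRing A] : IsCancelAdd (FClass F) :=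
  AddCommMagma.IsRightCancelAdd.toIsCancelAdd _

end FClass

/-- Modules with the same class in `K_F(A)` are `F`-equivalent. -/
lemma fEquivalent_of_classKF_eq [IsArtinianRing A] {M N : FGModuleCat.{u} A}
    (h : classKF F M = classKF F N) : FEquivalent F M N := by
  let φ : FreeAbelianGroup (IsoClass A) →+ Algebra.GrothendieckAddGroup (FClass F) :=
    FreeAbelianGroup.lift (Quotient.lift
      (fun M => Algebra.GrothendieckAddGroup.of (FClass.mk F M)) fun M N e => by
        obtain ⟨e⟩ := nonempty_iso_iff.1 e
        rw [FClass.mk_eq_of_linearEquiv e])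
  have hφ (M : FGModuleCat.{u} A) :
      φ (gen M) = Algebra.GrothendieckAddGroup.of (FClass.mk F M) :=
    FreeAbelianGroup.lift_apply_of _ _
  have hle : AddSubgroup.closure (relKF F) ≤ φ.ker := by
    rw [AddSubgroup.closure_le]
    rintro x (⟨N, X, Y, e, rfl⟩ | ⟨P, hP, rfl⟩)
    · obtain ⟨e⟩ := nonempty_iso_iff.1 e
      change φ _ = 0
      rw [map_sub, map_sub, hφ, hφ, hφ, FClass.mk_eq_of_linearEquiv e, ← FClass.mk_add_mk, map_add]
      abel
    · change φ _ = 0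
      rw [hφ, FClass.mk_eq_zero hP, map_zero]
  have h₁ : -gen M + gen N ∈ AddSubgroup.closure (relKF F) := QuotientAddGroup.eq.1 h
  have h₂ : φ (-gen M + gen N) = 0 := hle h₁
  rw [map_add, map_neg, hφ, hφ, neg_add_eq_zero] at h₂
  exact FClass.mk_eq_mk_iff.1 (Algebra.GrothendieckAddGroup.of_injective h₂)

lemma classKF_dsum (M N : FGModuleCat.{u} A) :
    classKF F (dsum M N) = classKF F M + classKF F N := by
  have h : gen (dsum M N) - gen M - gen N ∈ AddSubgroup.closure (relKF F) :=
    AddSubgroup.subset_closure (Or.inl ⟨_, M, N, ⟨Iso.refl _⟩, rfl⟩)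
  have h' := (QuotientAddGroup.eq_zero_iff _).2 h
  rw [sub_sub, QuotientAddGroup.mk_sub, sub_eq_zero] at h'
  exact h'

lemma classKF_eq_zero {P : FGModuleCat.{u} A} (hP : FProjective F P) : classKF F P = 0 :=
  (QuotientAddGroup.eq_zero_iff _).2 (AddSubgroup.subset_closure (Or.inr ⟨P, hP, rfl⟩))

lemma classKF_eq_of_iso {M N : FGModuleCat.{u} A} (e : M ≅ N) : classKF F M = classKF F N :=
  congrArg (fun x => QuotientAddGroup.mk (FreeAbelianGroup.of x))
    (Quotient.sound (s := isIsomorphicSetoid (FGModuleCat.{u} A)) ⟨e⟩)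

lemma FEquivalent.classKF_eq {M N : FGModuleCat.{u} A} (h : FEquivalent F M N) :
    classKF F M = classKF F N := by
  obtain ⟨P, Q, hP, hQ, ⟨e⟩⟩ := h
  have h := classKF_eq_of_iso (F := F) (M := RelHom.dsum M P) (N := RelHom.dsum N Q)
    e.toFGModuleCatIso
  rwa [classKF_dsum, classKF_dsum, classKF_eq_zero hP, classKF_eq_zero hQ, add_zero, add_zero] at h

lemma fEquivalent_iff {M N : FGModuleCat.{u} A} :
    FEquivalent F M N ↔ ∃ P Q : FGModuleCat.{u} A, FProjective F P ∧ FProjective F Q ∧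
      Nonempty (dsum M P ≅ dsum N Q) := by
  simp only [nonempty_iso_iff]
  rfl

end RelHom

end

theorem proposition4p4 {R A : Type*} [CommRing R] [IsArtinianRing R] [Ring A] [Algebra R A]
    [Module.Finite R A] (F : RelHom.ExtSubbifunctor A) (hF : RelHom.EnoughFProjectives F)
    (M N : FGModuleCat A) :
    List.TFAE [
      -- the functors `Ext¹_F(M, -)` and `Ext¹_F(N, -)` are isomorphic
      Nonempty (RelHom.extF F M ≅ RelHom.extF F N),
      -- `M ⊕ P(N) ≅ N ⊕ P(M)` for `F`-projective covers `P(M)` of `M` and `P(N)` of `N`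
      ∃ (PM PN : FGModuleCat A) (p : PM ⟶ M) (q : PN ⟶ N),
        RelHom.IsFProjectiveCover F p ∧ RelHom.IsFProjectiveCover F q ∧
          Nonempty (RelHom.dsum M PN ≅ RelHom.dsum N PM),
      -- `M ⊕ P ≅ N ⊕ Q` for some `F`-projective modules `P` and `Q`
      ∃ P Q : FGModuleCat A, RelHom.FProjective F P ∧ RelHom.FProjective F Q ∧
        Nonempty (RelHom.dsum M P ≅ RelHom.dsum N Q),
      -- `M` and `N` are isomorphic in the `F`-stable category
      Nonempty (RelHom.toFStable F M ≅ RelHom.toFStable F N),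
      -- `[M] = [N]` in `K_F(A)`
      RelHom.classKF F M = RelHom.classKF F N] := by
  have : IsArtinianRing A := IsArtinianRing.of_finite R A
  rw [← RelHom.fEquivalent_iff, RelHom.nonempty_iso_toFStable_iff]
  tfae_have 1 → 4 := fun ⟨φ⟩ => RelHom.exists_stable_of_extF_iso hF φ
  tfae_have 4 → 1 := fun ⟨_, _, hfg, hgf⟩ => RelHom.nonempty_extF_iso_of_stable hfg hgf
  tfae_have 4 → 3 := fun ⟨_, _, hfg, hgf⟩ => RelHom.fEquivalent_of_stable hfg hgf
  tfae_have 3 → 4 := fun h => RelHom.nonempty_iso_toFStable_iff.1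
    (RelHom.nonempty_iso_toFStable_of_fEquivalent h)
  tfae_have 3 → 2 := fun h => h.exists_cover hF
  tfae_have 2 → 3 := fun ⟨PM, PN, _, _, hp, hq, e⟩ =>
    RelHom.fEquivalent_iff.2 ⟨PN, PM, hq.1, hp.1, e⟩
  tfae_have 3 → 5 := fun h => h.classKF_eq
  tfae_have 5 → 3 := RelHom.fEquivalent_of_classKF_eq
  tfae_finish
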